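/- Let $(\Omega,\mathcal F,\mathbb P)$ be a probability space and let $B^H=\{B^H_t,\ t\ge 0\}$ be a fractional Brownian motion with Hurst index $H\in(0,\tfrac12)$, i.e. a centred Gaussian process with almost surely continuous paths and $\mathbb E\,B^H_tB^H_s=\tfrac12\left(t^{2H}+s^{2H}-|t-s|^{2H}\right)$ for $s,t\ge 0$. Let $X_0,a,\sigma>0$ be constants. For $\varepsilon>0$ let $Y^\varepsilon$ be the (pathwise, continuous) solution of $$Y^\varepsilon_t=X_0+a\int_0^t\frac{ds}{Y^\varepsilon_s\mathbf 1_{\{Y^\varepsilon_s>0\}}+\varepsilon}+\sigma B^H_t,\qquad t\ge 0,$$ and let $$X^H_t=\lim_{\varepsilon\downarrow 0}Y^\varepsilon_t,\qquad L^H_t=X^H_t-X_0-a\int_0^t\frac{ds}{X^H_s}-\sigma B^H_t,\qquad t\ge 0.$$ Then these objects are well defined almost surely: a.s., for every $\varepsilon>0$ the regularized equation has exactly one continuous solution on $[0,\infty)$; a.s. the limit $X^H_t$ exists as a finite number for all $t\ge 0$; and a.s. $X^H_t\ge 0$ for all $t\ge0$, $X^H_s>0$ for Lebesgue-almost every $s\ge0$,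 and $\int_0^t ds/X^H_s<\infty$ for all $t\ge 0$. Moreover, almost surely: 1. $L^H_0=0$; 2. $t\mapsto L^H_t$ is nondecreasing on $[0,\infty)$; 3. $t\mapsto L^H_t$ is continuous at Lebesgue-almost every $t\ge 0$; 4. $L^H$ can increase only at times $t$ with $X^H_t=0$: if $t\ge 0$ is such that every neighbourhood of $t$ in $[0,\infty)$ contains $u<v$ with $L^H_u<L^H_v$, then $X^H_t=0$; 5. $X^H$ satisfies the reflected equation $X^H_t=X_0+a\int_0^t\frac{ds}{X^H_s}+\sigma B^H_t+L^H_t$ for all $t\ge 0$. -/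

import Mathlib

open MeasureTheory ProbabilityTheory Filter Topology
open scoped NNReal

noncomputable section

namespace FracBessel

/-- `B = (B_t)_{t ≥ 0}` is a fractional Brownian motion with Hurst index `H` on `(Ω, P)`: a centred
Gaussian process with covariance `(t^{2H} + s^{2H} - |t - s|^{2H}) / 2` and, as for Mathlib's
Brownian motion, almost surely continuous paths. -/
structure IsFractionalBrownianMotion {Ω : Type*} [MeasurableSpace Ω] (H : ℝ)
    (B : ℝ≥0 → Ω → ℝ) (P : Measure Ω) : Prop where
  isGaussianProcess : IsGaussianProcess B P
  integral_eq_zero : ∀ t, ∫ ω, B t ω ∂P = 0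
  integral_mul : ∀ s t : ℝ≥0, ∫ ω, B t ω * B s ω ∂P =
    ((t : ℝ) ^ (2 * H) + (s : ℝ) ^ (2 * H) - |(t : ℝ) - (s : ℝ)| ^ (2 * H)) / 2
  cont : ∀ᵐ ω ∂P, Continuous (fun t => B t ω)

/-- The continuous function `y` on `[0, ∞)` solves, along the driving path `b`,
`y_t = x₀ + a ∫₀ᵗ ds / (y_s 1_{y_s > 0} + ε) + σ b_t` for all `t ≥ 0`. -/
structure IsRegularizedSolution (x₀ a σ ε : ℝ) (b y : ℝ≥0 → ℝ) : Prop where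
  cont : Continuous y
  eq : ∀ t : ℝ≥0, y t = x₀ + a * (∫ s in (0 : ℝ)..t,
    1 / (y s.toNNReal * (Set.Ioi (0 : ℝ)).indicator 1 (y s.toNNReal) + ε)) + σ * b t

/-- The solution of the `ε`-regularized equation along the driving path `b` (an arbitrary function
if there is no solution). -/
def regularizedPath (x₀ a σ : ℝ) (b : ℝ≥0 → ℝ) (ε : ℝ) : ℝ≥0 → ℝ :=
  Classical.epsilon (IsRegularizedSolution x₀ a σ ε b)

/-- The pointwise limit, as `ε ↓ 0`, of the solutions of the `ε`-regularized equations along the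
driving path `b`. -/
def limitPath (x₀ a σ : ℝ) (b : ℝ≥0 → ℝ) (t : ℝ≥0) : ℝ :=
  limUnder (𝓝[>] (0 : ℝ)) (fun ε => regularizedPath x₀ a σ b ε t)

/-- The fractional diffusion Bessel process driven by `B`. -/
def besselProcess {Ω : Type*} (x₀ a σ : ℝ) (B : ℝ≥0 → Ω → ℝ) (t : ℝ≥0) (ω : Ω) : ℝ :=
  limitPath x₀ a σ (fun s => B s ω) t

/-- `L_t = X_t - x₀ - a ∫₀ᵗ ds / X_s - σ B_t`, where `X` is the fractional diffusion Bessel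
process driven by `B`. -/
def reflectionProcess {Ω : Type*} (x₀ a σ : ℝ) (B : ℝ≥0 → Ω → ℝ) (t : ℝ≥0) (ω : Ω) : ℝ :=
  besselProcess x₀ a σ B t ω - x₀
    - a * (∫ s in (0 : ℝ)..t, 1 / besselProcess x₀ a σ B s.toNNReal ω) - σ * B t ω

/-- `t` is a point of increase of `l : [0, ∞) → ℝ`: in every neighbourhood `(t - h, t + h)` of `t`
in `[0, ∞)` there are points `u < v` with `l u < l v`. -/
def IsPointOfIncrease (l : ℝ≥0 → ℝ) (t : ℝ≥0) : Prop :=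
  ∀ h : ℝ, 0 < h → ∃ u v : ℝ≥0, (t : ℝ) - h < u ∧ u < v ∧ (v : ℝ) < t + h ∧ l u < l v

end FracBessel

end

/-!
The statement is pathwise: the only facts about fractional Brownian motion that enter are that
almost every path `b` is continuous and starts at `0`, the latter because `E[B_0 ^ 2] = 0`.

Fix such a path. The drift `x ↦ a / (x⁺ + ε)` is bounded, Lipschitz and nonincreasing, so the
Picard–Lindelöf theorem yields a solution on `[0, n]` for every `n`. Since the drift decreases in
`x`, two solutions can be compared after the last time at which they were ordered
(`integralEq_le`); this gives uniqueness, lets the local solutions be glued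
(`exists_integralEq`), and shows that `Y^ε` increases as `ε` decreases. After the last time at which
`Y^ε ≤ x₀` the drift is at most `a / x₀`, which bounds `Y^ε_t` uniformly in `ε`
(`IsRegularizedSolution.le_add`), so the monotone limit `X` exists and is finite. It is nonnegative
(`limitPath_nonneg`), because below `0` the drift is the large constant `a / ε`.

The accumulated drift of `Y^ε` on `[s, t]` equals `Y^ε_t - Y^ε_s - σ (b_t - b_s)` and therefore
converges. Fatou's lemma (`lintegral_div_limitPath_le`) bounds the integral of `a / X` over `[s, t]`
by the limit, with the convention `a / 0 = ∞`. Hence `X > 0` almost everywhere and `1 / X` is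
locally integrable; moreover `L_t - L_s` is exactly the gap in Fatou's inequality, so `L` is nondecreasing,
and a monotone function has at most countably many discontinuities. Finally, if `X_t > 0`, then some
`Y^{ε₀}` exceeds a positive constant on a neighbourhood of `t`, and by monotonicity so does `Y^ε`
for every `ε ≤ ε₀`; dominated convergence closes the gap on that neighbourhood
(`integral_div_limitPath_eq`), so `t` is not a point of increase of `L`.
-/

namespace FracBessel

open Set

/-! ### Integral equations with an antitone drift -/

/-- A continuous function that is nonpositive at `0` and positive at `t` has a last time before `t`
at which it is nonpositive. -/
lemma exists_last_nonpos {D : ℝ → ℝ} (hD : Continuous D) (h0 : D 0 ≤ 0) {t : ℝ} (ht : 0 ≤ t)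
    (hDt : 0 < D t) : ∃ s, 0 ≤ s ∧ s < t ∧ D s ≤ 0 ∧ ∀ u ∈ Ioc s t, 0 < D u := by
  have hcomp : IsCompact (Icc 0 t ∩ D ⁻¹' Iic 0) :=
    isCompact_Icc.inter_right (isClosed_Iic.preimage hD)
  obtain ⟨s, ⟨⟨hs0, hst⟩, hs⟩, hmax⟩ := hcomp.exists_isGreatest ⟨0, ⟨le_rfl, ht⟩, h0⟩
  have hs' : D s ≤ 0 := hs
  refine ⟨s, hs0, lt_of_le_of_ne hst ?_, hs', fun u hu => ?_⟩
  · rintro rfl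
    exact hDt.not_ge hs'
  · by_contra! hneg
    exact hu.1.not_ge (hmax ⟨⟨hs0.trans hu.1.le, hu.2⟩, hneg⟩)

/-- Subtracting the values at two times of an integral equation. -/
lemma integralEq_sub {φ c p : ℝ → ℝ} {T : ℝ} (hφ : Continuous φ) (hp : Continuous p)
    (heq : ∀ t ∈ Icc 0 T, p t = c t + ∫ s in (0 : ℝ)..t, φ (p s)) {s t : ℝ}
    (hs : s ∈ Icc 0 T) (ht : t ∈ Icc 0 T) :
    p t - p s = c t - c s + ∫ u in s..t, φ (p u) := by
  have hi : ∀ u v : ℝ, IntervalIntegrable (fun r => φ (p r)) volume u v :=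
    fun u v => (hφ.comp hp).intervalIntegrable u v
  rw [heq t ht, heq s hs, ← intervalIntegral.integral_add_adjacent_intervals (hi 0 s) (hi s t)]
  ring

/-- Comparison principle: with an antitone drift, a larger drift yields a larger solution. After the
last time at which `p ≤ q`, the difference `p - q` would have a nonpositive derivative. -/
lemma integralEq_le {φ ψ c p q : ℝ → ℝ} {T : ℝ} (hφ : Continuous φ) (hψ : Continuous ψ)
    (hanti : Antitone φ) (hle : ∀ x, φ x ≤ ψ x) (hp : Continuous p) (hq : Continuous q)
    (hpe : ∀ t ∈ Icc 0 T, p t = c t + ∫ s in (0 : ℝ)..t, φ (p s))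
    (hqe : ∀ t ∈ Icc 0 T, q t = c t + ∫ s in (0 : ℝ)..t, ψ (q s)) :
    ∀ t ∈ Icc 0 T, p t ≤ q t := by
  intro t ht
  by_contra! hlt
  have h0 : (0 : ℝ) ∈ Icc 0 T := ⟨le_rfl, ht.1.trans ht.2⟩
  obtain ⟨s, hs0, hst, hs, hpos⟩ := exists_last_nonpos (hp.sub hq)
    (by simp [hpe 0 h0, hqe 0 h0]) ht.1 (sub_pos.2 hlt)
  simp only [Pi.sub_apply] at hs hpos
  have hsT : s ∈ Icc 0 T := ⟨hs0, hst.le.trans ht.2⟩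
  have hint : (∫ u in s..t, φ (p u)) ≤ ∫ u in s..t, ψ (q u) := by
    refine intervalIntegral.integral_mono_on_of_le_Ioo hst.le
      ((hφ.comp hp).intervalIntegrable _ _) ((hψ.comp hq).intervalIntegrable _ _) fun u hu => ?_
    have := hpos u ⟨hu.1, hu.2.le⟩
    exact (hanti (by linarith)).trans (hle _)
  have h1 := integralEq_sub hφ hp hpe hsT ht
  have h2 := integralEq_sub hψ hq hqe hsT ht
  linarith

/-- Solvability on a bounded interval, by the Picard–Lindelöf theorem applied to `p - c`. As the
drift is bounded by `M`, a ball of radius `M * T` suffices for the whole interval. -/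
lemma exists_integralEq_Icc {φ c : ℝ → ℝ} {K M : ℝ≥0} (hφ : LipschitzWith K φ)
    (hM : ∀ x, ‖φ x‖ ≤ M) (hc : Continuous c) (T : ℝ≥0) :
    ∃ p : ℝ → ℝ, Continuous p ∧
      ∀ t ∈ Icc (0 : ℝ) T, p t = c t + ∫ s in (0 : ℝ)..t, φ (p s) := by
  have hT : (0 : ℝ) ≤ T := T.2
  have hPL : IsPicardLindelof (fun t x => φ (x + c t)) (⟨0, le_rfl, hT⟩ : Icc (0 : ℝ) T)
      (0 : ℝ) (M * T) 0 M K :=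
    { lipschitzOnWith := fun t _ => by
        refine (LipschitzWith.of_dist_le_mul fun x y => ?_).lipschitzOnWith
        simpa using hφ.dist_le_mul (x + c t) (y + c t)
      continuousOn := fun x _ => (hφ.continuous.comp (continuous_const.add hc)).continuousOn
      norm_le := fun t _ x _ => hM _
      mul_max_le := by simp }
  obtain ⟨α, hα0, hα⟩ := hPL.exists_eq_forall_mem_Icc_hasDerivWithinAt
    (x := 0) (by simp)
  have hα0' : α 0 = 0 := hα0
  have hαc : ContinuousOn α (Icc (0 : ℝ) T) := HasDerivWithinAt.continuousOn hα
  refine ⟨fun t => α (projIcc 0 (T : ℝ) hT t) + c t,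
    ((continuousOn_iff_continuous_domRestrict.1 hαc).comp continuous_projIcc).add hc,
    fun t ht => ?_⟩
  have hsub : uIcc 0 t ⊆ Icc (0 : ℝ) T := by
    rw [uIcc_of_le ht.1]
    exact Icc_subset_Icc_right ht.2
  have hpic := ODE.picard_eq_of_hasDerivAt (f := fun t x => φ (x + c t)) (t₀ := 0) (t := t)
    (α := α) (u := univ)
    (hφ.continuous.comp (continuous_snd.add (hc.comp continuous_fst))).continuousOn
    (fun t' ht' => (hα t' (hsub ht')).mono hsub) (mapsTo_univ _ _)
  rw [ODE.picard_apply, hα0', zero_add] at hpic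
  simp only [projIcc_of_mem hT ht, ← hpic]
  rw [add_comm]
  congr 1
  refine intervalIntegral.integral_congr fun s hs => ?_
  simp only [projIcc_of_mem hT (hsub hs)]

/-- Global solvability for a bounded Lipschitz antitone drift: the solutions on the intervals
`[0, n]` agree where they are both defined, by the comparison principle. -/
lemma exists_integralEq {φ c : ℝ → ℝ} {K M : ℝ≥0} (hφ : LipschitzWith K φ)
    (hM : ∀ x, ‖φ x‖ ≤ M) (hanti : Antitone φ) (hc : Continuous c) :
    ∃ p : ℝ → ℝ, Continuous p ∧ ∀ t, 0 ≤ t → p t = c t + ∫ s in (0 : ℝ)..t, φ (p s) := by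
  choose p hpc hpe using fun n : ℕ => exists_integralEq_Icc hφ hM hc n
  have hle : ∀ m n : ℕ, ∀ t : ℝ, 0 ≤ t → t ≤ m → t ≤ n → p m t ≤ p n t := fun m n t h0 hm hn =>
    integralEq_le (T := t) hφ.continuous hφ.continuous hanti (fun _ => le_rfl) (hpc m) (hpc n)
      (fun s hs => hpe m s ⟨hs.1, by simpa using hs.2.trans hm⟩)
      (fun s hs => hpe n s ⟨hs.1, by simpa using hs.2.trans hn⟩) t ⟨h0, le_rfl⟩
  have hagree : ∀ n : ℕ, ∀ t : ℝ, 0 ≤ t → t ≤ n → p ⌈t⌉₊ t = p n t := fun n t h0 hn =>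
    (hle _ _ t h0 (Nat.le_ceil t) hn).antisymm (hle _ _ t h0 hn (Nat.le_ceil t))
  refine ⟨fun t => p ⌈max t 0⌉₊ (max t 0), ?_, fun t ht => ?_⟩
  · rw [continuous_iff_continuousAt]
    intro t
    obtain ⟨n, hn⟩ := exists_nat_gt (max t 0)
    have hcm : Continuous fun s : ℝ => max s 0 := continuous_id.max continuous_const
    refine ((hpc n).comp hcm).continuousAt.congr ?_
    filter_upwards [hcm.continuousAt.eventually_lt continuousAt_const hn] with s hs
    exact (hagree n _ (le_max_right _ _) hs.le).symm
  · simp only [max_eq_left ht]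
    rw [hpe ⌈t⌉₊ t ⟨ht, by simpa using Nat.le_ceil t⟩]
    congr 1
    refine intervalIntegral.integral_congr fun s hs => ?_
    rw [uIcc_of_le ht] at hs
    simp only [max_eq_left hs.1]
    rw [hagree ⌈t⌉₊ s hs.1 (hs.2.trans (Nat.le_ceil t))]

/-! ### The regularized equation -/

/-- The drift `x ↦ a / (x⁺ + ε)` of the regularized equation. -/
noncomputable def regularizedDrift (a ε x : ℝ) : ℝ := a / (max x 0 + ε)

lemma mul_indicator_eq_max (x : ℝ) : x * (Ioi (0 : ℝ)).indicator 1 x = max x 0 := by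
  by_cases hx : 0 < x
  · simp [hx, max_eq_left hx.le]
  · simp [hx, max_eq_right (not_lt.1 hx)]

section Drift

variable {a ε : ℝ}

lemma max_zero_add_pos (hε : 0 < ε) (x : ℝ) : 0 < max x 0 + ε :=
  add_pos_of_nonneg_of_pos (le_max_right _ _) hε

lemma regularizedDrift_nonneg (ha : 0 ≤ a) (hε : 0 < ε) (x : ℝ) : 0 ≤ regularizedDrift a ε x :=
  div_nonneg ha (max_zero_add_pos hε x).le

lemma continuous_regularizedDrift (hε : 0 < ε) : Continuous (regularizedDrift a ε) :=
  continuous_const.div ((continuous_id.max continuous_const).add continuous_const)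
    fun x => (max_zero_add_pos hε x).ne'

lemma antitone_regularizedDrift (ha : 0 ≤ a) (hε : 0 < ε) : Antitone (regularizedDrift a ε) := by
  intro x y hxy
  have := max_zero_add_pos hε x
  unfold regularizedDrift
  gcongr

lemma regularizedDrift_le_of_le {ε' : ℝ} (ha : 0 ≤ a) (hε : 0 < ε) (h : ε ≤ ε') (x : ℝ) :
    regularizedDrift a ε' x ≤ regularizedDrift a ε x := by
  have := max_zero_add_pos hε x
  unfold regularizedDrift
  gcongr

lemma regularizedDrift_le_div {δ x : ℝ} (ha : 0 ≤ a) (hε : 0 < ε) (hδ : 0 < δ) (hx : δ ≤ x) :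
    regularizedDrift a ε x ≤ a / δ := by
  unfold regularizedDrift
  gcongr
  linarith [le_max_left x 0]

lemma norm_regularizedDrift_le (ha : 0 ≤ a) (hε : 0 < ε) (x : ℝ) :
    ‖regularizedDrift a ε x‖ ≤ a / ε := by
  rw [Real.norm_of_nonneg (regularizedDrift_nonneg ha hε x)]
  unfold regularizedDrift
  gcongr
  linarith [le_max_right x 0]

lemma lipschitzWith_regularizedDrift (ha : 0 ≤ a) (hε : 0 < ε) :
    LipschitzWith (Real.toNNReal (a / (ε * ε))) (regularizedDrift a ε) := by
  refine LipschitzWith.of_dist_le_mul fun x y => ?_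
  have hx := max_zero_add_pos hε x
  have hy := max_zero_add_pos hε y
  rw [Real.coe_toNNReal _ (by positivity), Real.dist_eq, Real.dist_eq]
  have h1 : regularizedDrift a ε x - regularizedDrift a ε y =
      a * (max y 0 - max x 0) / ((max x 0 + ε) * (max y 0 + ε)) := by
    unfold regularizedDrift
    field_simp
    ring
  rw [h1, abs_div, abs_mul, abs_of_nonneg ha, abs_of_pos (mul_pos hx hy), div_mul_eq_mul_div]
  have h2 : |max y 0 - max x 0| ≤ |x - y| := by
    rw [abs_sub_comm x y]
    exact abs_max_sub_max_le_abs y x 0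
  gcongr
  · linarith [le_max_right x 0]
  · linarith [le_max_right y 0]

end Drift

section Solution

variable {x₀ a σ ε : ℝ} {b y : ℝ≥0 → ℝ}

lemma mul_integral_eq_integral_regularizedDrift (a ε : ℝ) (y : ℝ≥0 → ℝ) (u v : ℝ) :
    a * (∫ s in u..v, 1 / (y s.toNNReal * (Ioi (0 : ℝ)).indicator 1 (y s.toNNReal) + ε)) =
      ∫ s in u..v, regularizedDrift a ε (y s.toNNReal) := by
  rw [← intervalIntegral.integral_const_mul]
  simp only [mul_indicator_eq_max, regularizedDrift, mul_one_div]

/-- The regularized equation, for the path extended to the real line by `s ↦ y s⁺`. -/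
lemma IsRegularizedSolution.eq_integral (h : IsRegularizedSolution x₀ a σ ε b y) (t : ℝ)
    (ht : 0 ≤ t) : y t.toNNReal = x₀ + σ * b t.toNNReal +
      ∫ s in (0 : ℝ)..t, regularizedDrift a ε (y s.toNNReal) := by
  rw [h.eq, mul_integral_eq_integral_regularizedDrift, Real.coe_toNNReal t ht]
  ring

lemma IsRegularizedSolution.continuous_toNNReal (h : IsRegularizedSolution x₀ a σ ε b y) :
    Continuous fun t : ℝ => y t.toNNReal :=
  h.cont.comp continuous_real_toNNReal

lemma IsRegularizedSolution.sub_eq_integral (h : IsRegularizedSolution x₀ a σ ε b y)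
    (hε : 0 < ε) {s t : ℝ} (hs : 0 ≤ s) (hst : s ≤ t) :
    y t.toNNReal - y s.toNNReal = σ * b t.toNNReal - σ * b s.toNNReal +
      ∫ u in s..t, regularizedDrift a ε (y u.toNNReal) := by
  have := integralEq_sub (T := t) (c := fun t => x₀ + σ * b t.toNNReal)
    (continuous_regularizedDrift hε) h.continuous_toNNReal
    (fun u hu => h.eq_integral u hu.1) ⟨hs, hst⟩ ⟨hs.trans hst, le_rfl⟩
  linarith

/-- Solutions increase as the regularization parameter decreases; the case `ε = ε'` is
uniqueness. -/
lemma IsRegularizedSolution.le {ε' : ℝ} {y' : ℝ≥0 → ℝ} (ha : 0 ≤ a) (hε : 0 < ε) (hεε' : ε ≤ ε')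
    (h : IsRegularizedSolution x₀ a σ ε b y) (h' : IsRegularizedSolution x₀ a σ ε' b y') :
    y' ≤ y := by
  intro t
  simpa using integralEq_le (T := t) (continuous_regularizedDrift (hε.trans_le hεε'))
    (continuous_regularizedDrift hε) (antitone_regularizedDrift ha (hε.trans_le hεε'))
    (regularizedDrift_le_of_le ha hε hεε') h'.continuous_toNNReal h.continuous_toNNReal
    (fun s hs => h'.eq_integral s hs.1) (fun s hs => h.eq_integral s hs.1) t ⟨t.2, le_rfl⟩

lemma exists_isRegularizedSolution (x₀ σ : ℝ) (ha : 0 ≤ a) (hε : 0 < ε) (hb : Continuous b) :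
    ∃ y, IsRegularizedSolution x₀ a σ ε b y := by
  obtain ⟨p, hpc, hpe⟩ := exists_integralEq (c := fun t => x₀ + σ * b t.toNNReal)
    (M := (a / ε).toNNReal) (lipschitzWith_regularizedDrift ha hε)
    (fun x => by
      rw [Real.coe_toNNReal _ (by positivity)]
      exact norm_regularizedDrift_le ha hε x)
    (antitone_regularizedDrift ha hε)
    (continuous_const.add (continuous_const.mul (hb.comp continuous_real_toNNReal)))
  refine ⟨fun t => p t, hpc.comp NNReal.continuous_coe, fun t => ?_⟩
  rw [mul_integral_eq_integral_regularizedDrift a ε (fun t => p t), hpe t t.2,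
    Real.toNNReal_coe]
  have : (∫ s in (0 : ℝ)..t, regularizedDrift a ε (p s)) =
      ∫ s in (0 : ℝ)..t, regularizedDrift a ε (p s.toNNReal) := by
    refine intervalIntegral.integral_congr fun s hs => ?_
    rw [uIcc_of_le t.coe_nonneg] at hs
    simp only [Real.coe_toNNReal s hs.1]
  rw [this]
  ring

lemma isRegularizedSolution_regularizedPath (x₀ σ : ℝ) (ha : 0 ≤ a) (hε : 0 < ε)
    (hb : Continuous b) :
    IsRegularizedSolution x₀ a σ ε b (regularizedPath x₀ a σ b ε) :=
  Classical.epsilon_spec (exists_isRegularizedSolution x₀ σ ha hε hb)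

lemma IsRegularizedSolution.eq_regularizedPath (ha : 0 ≤ a) (hε : 0 < ε) (hb : Continuous b)
    (h : IsRegularizedSolution x₀ a σ ε b y) : y = regularizedPath x₀ a σ b ε :=
  have h' := isRegularizedSolution_regularizedPath x₀ σ ha hε hb
  le_antisymm (h'.le ha hε le_rfl h) (h.le ha hε le_rfl h')

/-- An upper bound that does not depend on `ε`: after the last time at which `y ≤ x₀` the drift is
at most `a / x₀`. -/
lemma IsRegularizedSolution.le_add (ha : 0 ≤ a) (hε : 0 < ε) (hx₀ : 0 < x₀) (hb0 : b 0 = 0)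
    (h : IsRegularizedSolution x₀ a σ ε b y) {t : ℝ≥0} {C : ℝ}
    (hC : ∀ s ≤ t, |σ * b s| ≤ C) : y t ≤ x₀ + a / x₀ * t + 2 * C := by
  have hC0 : 0 ≤ C := (abs_nonneg _).trans (hC t le_rfl)
  have ht0 : (0 : ℝ) ≤ t := t.2
  have hat : 0 ≤ a / x₀ * t := by positivity
  by_contra! hlt
  have hy0 : y 0 = x₀ := by simpa [hb0] using h.eq_integral 0 le_rfl
  obtain ⟨s, hs0, hst, hs, hpos⟩ := exists_last_nonpos (D := fun t => y t.toNNReal - x₀)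
    (h.continuous_toNNReal.sub continuous_const) (by simp [hy0]) ht0
    (by simp only [Real.toNNReal_coe]; linarith)
  have hsub := h.sub_eq_integral hε hs0 hst.le
  have hint : (∫ u in s..t, regularizedDrift a ε (y u.toNNReal)) ≤ ∫ _ in s..t, a / x₀ := by
    refine intervalIntegral.integral_mono_on_of_le_Ioo hst.le
      (((continuous_regularizedDrift hε).comp h.continuous_toNNReal).intervalIntegrable _ _)
      (intervalIntegrable_const) fun u hu => ?_
    have := hpos u ⟨hu.1, hu.2.le⟩
    exact regularizedDrift_le_div ha hε hx₀ (by linarith)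
  rw [intervalIntegral.integral_const, smul_eq_mul] at hint
  have hm : (t - s) * (a / x₀) ≤ a / x₀ * t := by
    rw [mul_comm]
    gcongr
    linarith
  have h1 := abs_le.1 (hC t le_rfl)
  have h2 := abs_le.1 (hC s.toNNReal (Real.toNNReal_le_iff_le_coe.2 hst.le))
  rw [Real.toNNReal_coe] at hsub
  linarith [h1.2, h2.1]

end Solution

/-! ### The limit path -/

section Limit

variable {x₀ a σ : ℝ} {b : ℝ≥0 → ℝ}

lemma antitoneOn_regularizedPath (x₀ σ : ℝ) (ha : 0 ≤ a) (hb : Continuous b) (t : ℝ≥0) :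
    AntitoneOn (fun ε => regularizedPath x₀ a σ b ε t) (Ioi 0) := fun _ hε _ hε' hle =>
  (isRegularizedSolution_regularizedPath x₀ σ ha hε hb).le ha hε hle
    (isRegularizedSolution_regularizedPath x₀ σ ha hε' hb) t

lemma exists_forall_abs_mul_le (σ : ℝ) (hb : Continuous b) (t : ℝ≥0) :
    ∃ C, ∀ s ≤ t, |σ * b s| ≤ C := by
  obtain ⟨C, hC⟩ := (isCompact_Icc (a := 0) (b := t)).exists_bound_of_continuousOn
    (continuous_const.mul hb : Continuous fun s => σ * b s).continuousOn
  exact ⟨C, fun s hs => hC s ⟨zero_le, hs⟩⟩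

theorem tendsto_limitPath (ha : 0 ≤ a) (hx₀ : 0 < x₀) (hb : Continuous b) (hb0 : b 0 = 0)
    (t : ℝ≥0) : Tendsto (fun ε => regularizedPath x₀ a σ b ε t) (𝓝[>] (0 : ℝ))
      (𝓝 (limitPath x₀ a σ b t)) := by
  obtain ⟨C, hC⟩ := exists_forall_abs_mul_le σ hb t
  have hbdd : BddAbove ((fun ε => regularizedPath x₀ a σ b ε t) '' Ioi 0) := by
    refine ⟨x₀ + a / x₀ * t + 2 * C, ?_⟩
    rintro _ ⟨ε, hε, rfl⟩
    exact (isRegularizedSolution_regularizedPath x₀ σ ha hε hb).le_add ha hε hx₀ hb0 hC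
  exact tendsto_nhds_limUnder ⟨_, (antitoneOn_regularizedPath x₀ σ ha hb t).tendsto_nhdsGT hbdd⟩

variable (ha : 0 < a) (hx₀ : 0 < x₀) (hb : Continuous b) (hb0 : b 0 = 0)

include ha hx₀ hb hb0

lemma regularizedPath_le_limitPath {ε : ℝ} (hε : 0 < ε) (t : ℝ≥0) :
    regularizedPath x₀ a σ b ε t ≤ limitPath x₀ a σ b t := by
  refine ge_of_tendsto (tendsto_limitPath ha.le hx₀ hb hb0 t) ?_
  filter_upwards [Ioc_mem_nhdsGT hε] with ε' hε'
  exact antitoneOn_regularizedPath x₀ σ ha.le hb t hε'.1 hε hε'.2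

omit hx₀ in
lemma regularizedPath_zero {ε : ℝ} (hε : 0 < ε) : regularizedPath x₀ a σ b ε 0 = x₀ := by
  simpa [hb0] using (isRegularizedSolution_regularizedPath x₀ σ ha.le hε hb).eq_integral 0 le_rfl

lemma limitPath_zero : limitPath x₀ a σ b 0 = x₀ := by
  refine tendsto_nhds_unique (tendsto_limitPath ha.le hx₀ hb hb0 0)
    (tendsto_const_nhds.congr' ?_)
  filter_upwards [self_mem_nhdsWithin] with ε hε
  exact (regularizedPath_zero ha hb hb0 hε).symm

/-- The limit path is nonnegative: on an excursion of the regularized path below `0` the drift is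
`a / ε`, which for small `ε` outweighs the driving path unless the excursion is so short that, by
uniform continuity, the driving path hardly moves. -/
theorem limitPath_nonneg (t : ℝ≥0) : 0 ≤ limitPath x₀ a σ b t := by
  by_contra! hneg
  obtain ⟨C, hC⟩ := exists_forall_abs_mul_le σ hb t
  have hC0 : 0 ≤ C := (abs_nonneg _).trans (hC t le_rfl)
  have huc := (isCompact_Icc (a := (0 : ℝ)) (b := t)).uniformContinuousOn_of_continuous
    (continuous_const.mul (hb.comp continuous_real_toNNReal) :
      Continuous fun s : ℝ => σ * b s.toNNReal).continuousOn
  obtain ⟨η, hη, huc⟩ := Metric.uniformContinuousOn_iff.1 huc _ (neg_pos.2 hneg)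
  -- With this `ε`, an excursion of length at least `η` gains at least `2 * C + 1`.
  set ε := a * η / (2 * C + 1) with hεdef
  have hε : 0 < ε := by positivity
  have hdrift : a / ε * η = 2 * C + 1 := by
    rw [hεdef]
    field_simp
  have hsol := isRegularizedSolution_regularizedPath x₀ σ ha.le hε hb
  have hYX := regularizedPath_le_limitPath (σ := σ) ha hx₀ hb hb0 hε t
  obtain ⟨s, hs0, hst, hs, hpos⟩ := exists_last_nonpos
    (D := fun u => -regularizedPath x₀ a σ b ε u.toNNReal)
    hsol.continuous_toNNReal.neg
    (by simpa [regularizedPath_zero (σ := σ) ha hb hb0 hε] using hx₀.le) t.coe_nonneg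
    (by simp only [Real.toNNReal_coe]; linarith)
  have hsub := hsol.sub_eq_integral hε hs0 hst.le
  have hint : (∫ u in s..t, regularizedDrift a ε (regularizedPath x₀ a σ b ε u.toNNReal)) =
      ∫ _ in s..t, a / ε := by
    refine intervalIntegral.integral_congr_uIoo fun u hu => ?_
    rw [uIoo_of_le hst.le] at hu
    have := hpos u ⟨hu.1, hu.2.le⟩
    simp only [regularizedDrift]
    rw [max_eq_right (by linarith), zero_add]
  rw [hint, intervalIntegral.integral_const, smul_eq_mul, Real.toNNReal_coe] at hsub
  have hgain : 0 ≤ (t - s) * (a / ε) := mul_nonneg (by linarith) (by positivity)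
  by_cases hlen : t - s < η
  · have hd := huc t ⟨t.coe_nonneg, le_rfl⟩ s ⟨hs0, hst.le⟩
      (by rwa [Real.dist_eq, abs_of_pos (by linarith)])
    simp only [Pi.mul_apply, Real.dist_eq, Real.toNNReal_coe] at hd
    linarith [(abs_lt.1 hd).1]
  · have hm : a / ε * η ≤ (t - s) * (a / ε) := by
      rw [mul_comm]
      gcongr
      linarith
    have h1 := abs_le.1 (hC t le_rfl)
    have h2 := abs_le.1 (hC s.toNNReal (Real.toNNReal_le_iff_le_coe.2 hst.le))
    linarith [h1.1, h2.2]

lemma measurable_limitPath : Measurable fun u : ℝ => limitPath x₀ a σ b u.toNNReal := by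
  obtain ⟨ε, -, hε, hlim⟩ := exists_seq_strictAnti_tendsto (0 : ℝ)
  refine measurable_of_tendsto_metrizable (f := fun n u =>
      regularizedPath x₀ a σ b (ε n) (Real.toNNReal u))
    (fun n => (isRegularizedSolution_regularizedPath x₀ σ ha.le
      (hε n) hb).continuous_toNNReal.measurable) ?_
  rw [tendsto_pi_nhds]
  exact fun u => (tendsto_limitPath ha.le hx₀ hb hb0 _).comp
    (tendsto_nhdsWithin_iff.2 ⟨hlim, Eventually.of_forall hε⟩)

/-- The accumulated drift of the regularized path on `[s, t]` converges, because all other terms of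
the regularized equation do. -/
lemma tendsto_integral_regularizedDrift {s t : ℝ≥0} (hst : s ≤ t) :
    Tendsto (fun ε => ∫ u in (s : ℝ)..t,
        regularizedDrift a ε (regularizedPath x₀ a σ b ε u.toNNReal)) (𝓝[>] (0 : ℝ))
      (𝓝 (limitPath x₀ a σ b t - limitPath x₀ a σ b s - (σ * b t - σ * b s))) := by
  refine (((tendsto_limitPath ha.le hx₀ hb hb0 t).sub
    (tendsto_limitPath ha.le hx₀ hb hb0 s)).sub_const (σ * b t - σ * b s)).congr' ?_
  filter_upwards [self_mem_nhdsWithin] with ε hε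
  have h := (isRegularizedSolution_regularizedPath x₀ σ ha.le hε hb).sub_eq_integral hε
    s.coe_nonneg (NNReal.coe_le_coe.2 hst)
  rw [Real.toNNReal_coe, Real.toNNReal_coe] at h
  linarith

lemma tendsto_max_add (t : ℝ≥0) :
    Tendsto (fun ε => max (regularizedPath x₀ a σ b ε t) 0 + ε) (𝓝[>] (0 : ℝ))
      (𝓝 (limitPath x₀ a σ b t)) := by
  have h := ((tendsto_limitPath (σ := σ) ha.le hx₀ hb hb0 t).max
    (tendsto_const_nhds (x := (0 : ℝ)))).add
    (tendsto_id.mono_left (nhdsWithin_le_nhds : 𝓝[>] (0 : ℝ) ≤ 𝓝 0))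
  rwa [max_eq_left (limitPath_nonneg ha hx₀ hb hb0 t), add_zero] at h

/-- The increment of `X - σ b` is a limit of accumulated nonnegative drifts. -/
lemma limitPath_sub_sub_nonneg {s t : ℝ≥0} (hst : s ≤ t) :
    0 ≤ limitPath x₀ a σ b t - limitPath x₀ a σ b s - (σ * b t - σ * b s) := by
  refine ge_of_tendsto (tendsto_integral_regularizedDrift ha hx₀ hb hb0 hst) ?_
  filter_upwards [self_mem_nhdsWithin] with ε hε
  exact intervalIntegral.integral_nonneg (NNReal.coe_le_coe.2 hst)
    fun u _ => regularizedDrift_nonneg ha.le hε _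

/-- Fatou's lemma for the drift terms. The integrand on the left is `∞` where the limit path
vanishes. -/
lemma lintegral_div_limitPath_le {s t : ℝ≥0} (hst : s ≤ t) :
    ∫⁻ u in Ioc (s : ℝ) t, ENNReal.ofReal a / ENNReal.ofReal (limitPath x₀ a σ b u.toNNReal) ≤
      ENNReal.ofReal (limitPath x₀ a σ b t - limitPath x₀ a σ b s - (σ * b t - σ * b s)) := by
  obtain ⟨ε, -, hε, hlim⟩ := exists_seq_strictAnti_tendsto (0 : ℝ)
  have hlim' : Tendsto ε atTop (𝓝[>] 0) :=
    tendsto_nhdsWithin_iff.2 ⟨hlim, Eventually.of_forall hε⟩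
  have hcont : ∀ n, Continuous fun u : ℝ =>
      regularizedDrift a (ε n) (regularizedPath x₀ a σ b (ε n) u.toNNReal) := fun n =>
    (continuous_regularizedDrift (hε n)).comp
      (isRegularizedSolution_regularizedPath x₀ σ ha.le (hε n) hb).continuous_toNNReal
  have hpt : ∀ u : ℝ, Tendsto (fun n => ENNReal.ofReal
      (regularizedDrift a (ε n) (regularizedPath x₀ a σ b (ε n) u.toNNReal))) atTop
      (𝓝 (ENNReal.ofReal a / ENNReal.ofReal (limitPath x₀ a σ b u.toNNReal))) := by
    intro u
    have h := ENNReal.Tendsto.const_div (a := ENNReal.ofReal a)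
      ((ENNReal.continuous_ofReal.tendsto _).comp
        ((tendsto_max_add (σ := σ) ha hx₀ hb hb0 u.toNNReal).comp hlim'))
      (Or.inr ENNReal.ofReal_ne_top)
    refine h.congr fun n => ?_
    exact (ENNReal.ofReal_div_of_pos (max_zero_add_pos (hε n) _)).symm
  have hint : ∀ n, ∫⁻ u in Ioc (s : ℝ) t, ENNReal.ofReal
      (regularizedDrift a (ε n) (regularizedPath x₀ a σ b (ε n) u.toNNReal)) =
      ENNReal.ofReal (∫ u in (s : ℝ)..t,
        regularizedDrift a (ε n) (regularizedPath x₀ a σ b (ε n) u.toNNReal)) := by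
    intro n
    rw [intervalIntegral.integral_of_le (NNReal.coe_le_coe.2 hst)]
    exact (ofReal_integral_eq_lintegral_ofReal
      (((hcont n).intervalIntegrable s t).1)
      (Eventually.of_forall fun u => regularizedDrift_nonneg ha.le (hε n) _)).symm
  calc ∫⁻ u in Ioc (s : ℝ) t, ENNReal.ofReal a / ENNReal.ofReal (limitPath x₀ a σ b u.toNNReal)
      = ∫⁻ u in Ioc (s : ℝ) t, liminf (fun n => ENNReal.ofReal
          (regularizedDrift a (ε n) (regularizedPath x₀ a σ b (ε n) u.toNNReal))) atTop :=
        lintegral_congr fun u => (hpt u).liminf_eq.symm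
    _ ≤ liminf (fun n => ∫⁻ u in Ioc (s : ℝ) t, ENNReal.ofReal
          (regularizedDrift a (ε n) (regularizedPath x₀ a σ b (ε n) u.toNNReal))) atTop :=
        lintegral_liminf_le fun n => (hcont n).measurable.ennreal_ofReal
    _ = _ := by
        simp only [hint]
        exact ((ENNReal.continuous_ofReal.tendsto _).comp
          ((tendsto_integral_regularizedDrift ha hx₀ hb hb0 hst).comp hlim')).liminf_eq

theorem ae_limitPath_pos : ∀ᵐ u : ℝ, 0 ≤ u → 0 < limitPath x₀ a σ b u.toNNReal := by
  have h : ∀ n : ℕ, ∀ᵐ u : ℝ, u ∈ Ioc (0 : ℝ) n → 0 < limitPath x₀ a σ b u.toNNReal := by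
    intro n
    have hle := lintegral_div_limitPath_le (σ := σ) ha hx₀ hb hb0
      (show (0 : ℝ≥0) ≤ (n : ℝ≥0) from zero_le)
    have hfin := ae_lt_top
      (measurable_const.div (measurable_limitPath ha hx₀ hb hb0).ennreal_ofReal)
      (hle.trans_lt ENNReal.ofReal_lt_top).ne
    rw [ae_restrict_iff' measurableSet_Ioc] at hfin
    filter_upwards [hfin] with u hu hun
    by_contra! hneg
    -- At a zero of `X` the integrand in Fatou's bound is `∞`.
    have := hu (by simpa using hun)
    simp [ENNReal.ofReal_of_nonpos hneg, ENNReal.div_zero, ha] at this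
  rw [← ae_all_iff] at h
  filter_upwards [h] with u hu hu0
  rcases hu0.eq_or_lt with rfl | hpos
  · simpa [limitPath_zero ha hx₀ hb hb0] using hx₀
  · obtain ⟨n, hn⟩ := exists_nat_ge u
    exact hu n ⟨hpos, hn⟩

/-- The bound for the real quotient `a / X`, which is `0` instead of `∞` where `X` vanishes. -/
lemma lintegral_ofReal_div_limitPath_le {s t : ℝ≥0} (hst : s ≤ t) :
    ∫⁻ u in Ioc (s : ℝ) t, ENNReal.ofReal (a / limitPath x₀ a σ b u.toNNReal) ≤
      ENNReal.ofReal (limitPath x₀ a σ b t - limitPath x₀ a σ b s - (σ * b t - σ * b s)) := by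
  refine (lintegral_mono fun u => ?_).trans (lintegral_div_limitPath_le ha hx₀ hb hb0 hst)
  rcases (limitPath_nonneg (σ := σ) ha hx₀ hb hb0 u.toNNReal).eq_or_lt with h | h
  · simp [← h]
  · exact (ENNReal.ofReal_div_of_pos h).le

lemma intervalIntegrable_div_limitPath {s t : ℝ≥0} (hst : s ≤ t) :
    IntervalIntegrable (fun u => a / limitPath x₀ a σ b u.toNNReal) volume s t := by
  rw [intervalIntegrable_iff_integrableOn_Ioc_of_le (NNReal.coe_le_coe.2 hst)]
  refine ⟨(measurable_const.div (measurable_limitPath ha hx₀ hb hb0)).aestronglyMeasurable, ?_⟩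
  rw [hasFiniteIntegral_iff_ofReal (Eventually.of_forall fun u =>
    div_nonneg ha.le (limitPath_nonneg ha hx₀ hb hb0 _))]
  exact (lintegral_ofReal_div_limitPath_le ha hx₀ hb hb0 hst).trans_lt ENNReal.ofReal_lt_top

/-- Fatou's bound for the Bochner integral of `a / X`. -/
lemma integral_div_limitPath_le {s t : ℝ≥0} (hst : s ≤ t) :
    ∫ u in (s : ℝ)..t, a / limitPath x₀ a σ b u.toNNReal ≤
      limitPath x₀ a σ b t - limitPath x₀ a σ b s - (σ * b t - σ * b s) := by
  rw [intervalIntegral.integral_of_le (NNReal.coe_le_coe.2 hst),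
    integral_eq_lintegral_of_nonneg_ae (Eventually.of_forall fun u =>
      div_nonneg ha.le (limitPath_nonneg ha hx₀ hb hb0 _))
      (measurable_const.div (measurable_limitPath ha hx₀ hb hb0)).aestronglyMeasurable]
  exact ENNReal.toReal_le_of_le_ofReal (limitPath_sub_sub_nonneg ha hx₀ hb hb0 hst)
    (lintegral_ofReal_div_limitPath_le ha hx₀ hb hb0 hst)

theorem intervalIntegrable_one_div_limitPath (t : ℝ≥0) :
    IntervalIntegrable (fun u : ℝ => 1 / limitPath x₀ a σ b u.toNNReal) volume 0 t := by
  have h := (intervalIntegrable_div_limitPath (σ := σ) ha hx₀ hb hb0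
    (zero_le : 0 ≤ t)).const_mul a⁻¹
  rw [NNReal.coe_zero] at h
  refine h.congr fun u _ => ?_
  field_simp

/-- Near a time at which the limit path is positive, it is bounded below by a positive constant,
uniformly in the regularization; hence the drift terms converge with no loss of mass. -/
lemma integral_div_limitPath_eq {δ ε₀ : ℝ} (hδ : 0 < δ) (hε₀ : 0 < ε₀) {s t : ℝ≥0} (hst : s ≤ t)
    (hlow : ∀ u ∈ Icc s t, δ ≤ regularizedPath x₀ a σ b ε₀ u) :
    ∫ u in (s : ℝ)..t, a / limitPath x₀ a σ b u.toNNReal =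
      limitPath x₀ a σ b t - limitPath x₀ a σ b s - (σ * b t - σ * b s) := by
  have hst' : (s : ℝ) ≤ t := NNReal.coe_le_coe.2 hst
  have hlow' : ∀ u ∈ uIoc (s : ℝ) t, δ ≤ regularizedPath x₀ a σ b ε₀ u.toNNReal := by
    intro u hu
    rw [uIoc_of_le hst'] at hu
    exact hlow _ ⟨NNReal.le_toNNReal_of_coe_le hu.1.le, Real.toNNReal_le_iff_le_coe.2 hu.2⟩
  refine tendsto_nhds_unique ?_ (tendsto_integral_regularizedDrift ha hx₀ hb hb0 hst)
  refine intervalIntegral.tendsto_integral_filter_of_dominated_convergence (fun _ => a / δ)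
    ?_ ?_ intervalIntegrable_const (Eventually.of_forall fun u hu => ?_)
  · filter_upwards [self_mem_nhdsWithin] with ε hε
    exact ((continuous_regularizedDrift hε).comp (isRegularizedSolution_regularizedPath x₀ σ ha.le
      hε hb).continuous_toNNReal).aestronglyMeasurable
  · filter_upwards [Ioc_mem_nhdsGT hε₀] with ε hε
    refine Eventually.of_forall fun u hu => ?_
    rw [Real.norm_of_nonneg (regularizedDrift_nonneg ha.le hε.1 _)]
    exact regularizedDrift_le_div ha.le hε.1 hδ
      ((hlow' u hu).trans (antitoneOn_regularizedPath x₀ σ ha.le hb _ hε.1 hε₀ hε.2))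
  · refine tendsto_const_nhds.div (tendsto_max_add ha hx₀ hb hb0 _) (ne_of_gt ?_)
    exact hδ.trans_le ((hlow' u hu).trans (regularizedPath_le_limitPath ha hx₀ hb hb0 hε₀ _))

end Limit

/-! ### The reflection term -/

section Reflection

/-- The reflection term `X_t - x₀ - a ∫₀ᵗ ds / X_s - σ b_t` of the limit path `X` along the driving
path `b`. -/
noncomputable def reflectionPath (x₀ a σ : ℝ) (b : ℝ≥0 → ℝ) (t : ℝ≥0) : ℝ :=
  limitPath x₀ a σ b t - x₀ - a * (∫ s in (0 : ℝ)..t, 1 / limitPath x₀ a σ b s.toNNReal) - σ * b t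

variable {x₀ a σ : ℝ} {b : ℝ≥0 → ℝ} (ha : 0 < a) (hx₀ : 0 < x₀) (hb : Continuous b) (hb0 : b 0 = 0)

include ha hx₀ hb hb0

lemma reflectionPath_zero : reflectionPath x₀ a σ b 0 = 0 := by
  simp [reflectionPath, limitPath_zero ha hx₀ hb hb0, hb0]

/-- The increment of `L` is the loss of mass in Fatou's bound `integral_div_limitPath_le`. -/
lemma reflectionPath_sub {s t : ℝ≥0} (hst : s ≤ t) :
    reflectionPath x₀ a σ b t - reflectionPath x₀ a σ b s =
      limitPath x₀ a σ b t - limitPath x₀ a σ b s - (σ * b t - σ * b s) -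
        ∫ u in (s : ℝ)..t, a / limitPath x₀ a σ b u.toNNReal := by
  have h0 := intervalIntegrable_div_limitPath (σ := σ) ha hx₀ hb hb0 (zero_le : 0 ≤ s)
  have h1 := intervalIntegrable_div_limitPath (σ := σ) ha hx₀ hb hb0 hst
  rw [NNReal.coe_zero] at h0
  simp only [reflectionPath, ← intervalIntegral.integral_const_mul, mul_one_div]
  rw [← intervalIntegral.integral_add_adjacent_intervals h0 h1]
  ring

theorem monotone_reflectionPath : Monotone (reflectionPath x₀ a σ b) := fun s t hst => by
  have := integral_div_limitPath_le (σ := σ) ha hx₀ hb hb0 hst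
  have := reflectionPath_sub (σ := σ) ha hx₀ hb hb0 hst
  linarith

theorem ae_continuousAt_reflectionPath :
    ∀ᵐ s : ℝ, 0 ≤ s → ContinuousAt (reflectionPath x₀ a σ b) s.toNNReal := by
  have hc := ((monotone_reflectionPath (σ := σ) ha hx₀ hb hb0).countable_not_continuousAt.image
    ((↑) : ℝ≥0 → ℝ)).ae_notMem volume
  filter_upwards [hc] with s hs hs0
  by_contra hns
  exact hs ⟨s.toNNReal, hns, Real.coe_toNNReal s hs0⟩

/-- Where the limit path is positive, one of the regularized paths is bounded below by a positive
constant on a neighbourhood, and the reflection term is constant there. -/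
theorem limitPath_eq_zero_of_isPointOfIncrease {t : ℝ≥0}
    (ht : IsPointOfIncrease (reflectionPath x₀ a σ b) t) : limitPath x₀ a σ b t = 0 := by
  by_contra hne
  have hpos : 0 < limitPath x₀ a σ b t :=
    lt_of_le_of_ne (limitPath_nonneg ha hx₀ hb hb0 t) (Ne.symm hne)
  obtain ⟨ε₀, hε₀lt, hε₀⟩ := (((tendsto_limitPath ha.le hx₀ hb hb0 t).eventually_const_lt
    (half_lt_self hpos)).and self_mem_nhdsWithin).exists
  have hcont := (isRegularizedSolution_regularizedPath x₀ σ ha.le hε₀ hb).cont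
  obtain ⟨h, hh, hball⟩ := Metric.eventually_nhds_iff.1
    (continuousAt_const.eventually_lt hcont.continuousAt hε₀lt)
  obtain ⟨u, v, hu, huv, hv, hlt⟩ := ht h hh
  have heq := integral_div_limitPath_eq ha hx₀ hb hb0 (half_pos hpos) hε₀ huv.le
    (fun r hr => (hball (y := r) (by
      have h1 : (u : ℝ) ≤ r := hr.1
      have h2 : (r : ℝ) ≤ v := hr.2
      rw [NNReal.dist_eq, abs_lt]
      constructor <;> linarith)).le)
  have := reflectionPath_sub (σ := σ) ha hx₀ hb hb0 huv.le
  linarith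

end Reflection

/-! ### Fractional Brownian motion starts at zero -/

lemma IsFractionalBrownianMotion.ae_zero {Ω : Type*} [MeasurableSpace Ω] {P : Measure Ω} {H : ℝ}
    (hH : H ≠ 0) {B : ℝ≥0 → Ω → ℝ} (hB : IsFractionalBrownianMotion H B P) :
    ∀ᵐ ω ∂P, B 0 ω = 0 := by
  have h0 : ∫ ω, B 0 ω ^ 2 ∂P = 0 := by
    simpa [sq, Real.zero_rpow (mul_ne_zero two_ne_zero hH)] using hB.integral_mul 0 0
  have hint := (hB.isGaussianProcess.hasGaussianLaw_eval 0).memLp_two.integrable_sq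
  have := (integral_eq_zero_iff_of_nonneg (fun ω => sq_nonneg (B 0 ω)) hint).1 h0
  filter_upwards [this] with ω hω
  simpa using hω

end FracBessel

theorem mainTheorem1 {Ω : Type*} [MeasurableSpace Ω] (P : Measure Ω) [IsProbabilityMeasure P]
    (H : ℝ) (hH0 : 0 < H) (hH : H < 1 / 2)
    (B : ℝ≥0 → Ω → ℝ) (hB : FracBessel.IsFractionalBrownianMotion H B P)
    (x₀ a σ : ℝ) (hx₀ : 0 < x₀) (ha : 0 < a) (hσ : 0 < σ) :
    -- The regularized equations are uniquely solvable and the pointwise limit `X` exists.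
    (∀ᵐ ω ∂P, ∀ ε : ℝ, 0 < ε →
      FracBessel.IsRegularizedSolution x₀ a σ ε (fun t => B t ω)
        (FracBessel.regularizedPath x₀ a σ (fun t => B t ω) ε) ∧
      ∀ y : ℝ≥0 → ℝ, FracBessel.IsRegularizedSolution x₀ a σ ε (fun t => B t ω) y →
        y = FracBessel.regularizedPath x₀ a σ (fun t => B t ω) ε) ∧
    (∀ᵐ ω ∂P, ∀ t : ℝ≥0,
      Tendsto (fun ε : ℝ => FracBessel.regularizedPath x₀ a σ (fun s => B s ω) ε t)
        (𝓝[>] (0 : ℝ)) (𝓝 (FracBessel.besselProcess x₀ a σ B t ω))) ∧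
    -- `X` is nonnegative, positive at almost every time, and `∫₀ᵗ ds / X_s` is finite.
    (∀ᵐ ω ∂P, ∀ t : ℝ≥0, 0 ≤ FracBessel.besselProcess x₀ a σ B t ω) ∧
    (∀ᵐ ω ∂P, ∀ᵐ s : ℝ, 0 ≤ s → 0 < FracBessel.besselProcess x₀ a σ B s.toNNReal ω) ∧
    (∀ᵐ ω ∂P, ∀ t : ℝ≥0, IntervalIntegrable
      (fun s : ℝ => 1 / FracBessel.besselProcess x₀ a σ B s.toNNReal ω) volume 0 t) ∧
    -- `L` starts at zero, is nondecreasing, is continuous at almost every time,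
    -- and can increase only at the zeros of `X`.
    (∀ᵐ ω ∂P, FracBessel.reflectionProcess x₀ a σ B 0 ω = 0) ∧
    (∀ᵐ ω ∂P, Monotone (fun t => FracBessel.reflectionProcess x₀ a σ B t ω)) ∧
    (∀ᵐ ω ∂P, ∀ᵐ s : ℝ, 0 ≤ s →
      ContinuousAt (fun t => FracBessel.reflectionProcess x₀ a σ B t ω) s.toNNReal) ∧
    (∀ᵐ ω ∂P, ∀ t : ℝ≥0,
      FracBessel.IsPointOfIncrease (fun u => FracBessel.reflectionProcess x₀ a σ B u ω) t →
        FracBessel.besselProcess x₀ a σ B t ω = 0) ∧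
    -- `X` solves the reflected equation.
    (∀ᵐ ω ∂P, ∀ t : ℝ≥0, FracBessel.besselProcess x₀ a σ B t ω =
      x₀ + a * (∫ s in (0 : ℝ)..t, 1 / FracBessel.besselProcess x₀ a σ B s.toNNReal ω)
        + σ * B t ω + FracBessel.reflectionProcess x₀ a σ B t ω) := by
  have hpath : ∀ᵐ ω ∂P, Continuous (fun t => B t ω) ∧ B 0 ω = 0 :=
    hB.cont.and (hB.ae_zero hH0.ne')
  refine ⟨?_, ?_, ?_, ?_, ?_, ?_, ?_, ?_, ?_, ?_⟩
  · filter_upwards [hpath] with ω ⟨hc, _⟩ ε hε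
    exact ⟨FracBessel.isRegularizedSolution_regularizedPath x₀ σ ha.le hε hc,
      fun y hy => hy.eq_regularizedPath ha.le hε hc⟩
  · filter_upwards [hpath] with ω ⟨hc, h0⟩ t
    exact FracBessel.tendsto_limitPath ha.le hx₀ hc h0 t
  · filter_upwards [hpath] with ω ⟨hc, h0⟩ t
    exact FracBessel.limitPath_nonneg ha hx₀ hc h0 t
  · filter_upwards [hpath] with ω ⟨hc, h0⟩
    exact FracBessel.ae_limitPath_pos ha hx₀ hc h0
  · filter_upwards [hpath] with ω ⟨hc, h0⟩ t
    exact FracBessel.intervalIntegrable_one_div_limitPath ha hx₀ hc h0 t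
  · filter_upwards [hpath] with ω ⟨hc, h0⟩
    exact FracBessel.reflectionPath_zero ha hx₀ hc h0
  · filter_upwards [hpath] with ω ⟨hc, h0⟩
    exact FracBessel.monotone_reflectionPath ha hx₀ hc h0
  · filter_upwards [hpath] with ω ⟨hc, h0⟩
    exact FracBessel.ae_continuousAt_reflectionPath ha hx₀ hc h0
  · filter_upwards [hpath] with ω ⟨hc, h0⟩ t ht
    exact FracBessel.limitPath_eq_zero_of_isPointOfIncrease ha hx₀ hc h0 ht
  · refine Eventually.of_forall fun ω t => ?_
    simp only [FracBessel.reflectionProcess]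
    ring
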